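/- For a permutation $\pi=\pi_1\pi_2\cdots\pi_n$ of $\{1,\dots,n\}$ let $\mathrm{des}(\pi)$ be the number of descents of $\pi$, i.e. of indices $1\le i\le n-1$ with $\pi_i>\pi_{i+1}$. Let $D_n(t)=\sum_{\pi} t^{\mathrm{des}(\pi)}$, where $\pi$ runs over all derangements (fixed-point free permutations) of $\{1,\dots,n\}$, and let $d_{n,k}$ be the coefficient of $t^k$ in $D_n(t)$. Then for all $n\ge 1$ and $1\le k\le n-1$, $$d_{2n,2n-k}<d_{2n,k}<d_{2n,2n-k-1}\qquad\text{and}\qquad d_{2n+1,k}<d_{2n+1,2n-k}<d_{2n+1,k+1},$$ with the single exception that for $n=2$, $k=1$ the inequality $d_{4,1}<d_{4,2}$ is replaced by the equality $d_{4,1}=d_{4,2}=4$. Moreover, for every $n\ge 2$ the polynomial $D_n(t)$ is unimodal: if $d$ is its degree, there is an index $0\le c\le d$ with $d_{n,0}\le d_{n,1}\le\cdots\le d_{n,c}\ge d_{n,c+1}\ge\cdots\ge d_{n,d}$. -/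

import Mathlib

open Polynomial

/-- The number of descents of a permutation `π` of `Fin n`, written as the word
`π 0, π 1, …, π (n - 1)`: the number of positions `i` that have a successor `i + 1` with
`π i > π (i + 1)`. The last position is never a descent. -/
def descentNumber {n : ℕ} (π : Equiv.Perm (Fin n)) : ℕ :=
  (Finset.univ.filter fun i : Fin n => ∃ h : (i : ℕ) + 1 < n, π ⟨(i : ℕ) + 1, h⟩ < π i).card

/-- The derangement descent polynomial `D_n(t) = ∑ t ^ des π`, summed over all fixed-point free
permutations `π` of an `n`-element chain. -/
noncomputable def derangementDescentPoly (n : ℕ) : ℤ[X] :=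
  ∑ π : derangements (Fin n), X ^ descentNumber (π : Equiv.Perm (Fin n))

/-- A polynomial `h_0 + h_1 t + ⋯ + h_d t ^ d` of degree `d` is unimodal if for some index `c ≤ d`
one has `h_0 ≤ h_1 ≤ ⋯ ≤ h_c ≥ h_{c+1} ≥ ⋯ ≥ h_d`. -/
def IsUnimodalPoly (h : ℤ[X]) : Prop :=
  ∃ c : ℕ, c ≤ h.natDegree ∧
    (∀ i : ℕ, i < c → h.coeff i ≤ h.coeff (i + 1)) ∧
    (∀ i : ℕ, c ≤ i → i < h.natDegree → h.coeff (i + 1) ≤ h.coeff i)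

/-! The coefficients of `derangementDescentPoly` obey an Eulerian recurrence with a single
correction term, and the inequalities follow from it by induction.

To obtain the recurrence, count the words of length n over m letters whose stable sorting
permutation is a derangement. Grouped by that permutation, they number a sum of binomial
coefficients weighted by the d_{n,k} (`card_sort_eq`). Counted directly, by inserting and deleting
fixed letters, they satisfy W_{n+1} = m W_n + (-1)^{n+1} C(m,n+1) (`cardNoFixed_succ`). Worpitzky's
identity turns this into the recurrence for `derangementEulerian`, and the binomial expansion
determines its coefficients.

For the inequalities, the two coefficients of the recurrence swap, up to a shift by one, when k is
reflected. The difference of two mirrored entries is thus essentially a nonnegative combination of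
such differences in the row above, so `EvenChain` and `OddChain` imply each other alternately. The
inequalities in one row interlace into a spiral towards the middle entry, which gives unimodality.
-/

/-- The triangular array given by the Eulerian-type recurrence
`d (n + 1) k = (k + 1) d n k + (n + 1 - k) d n (k - 1) + (-1) ^ (n + 1) [k = n]`. -/
def derangementEulerian : ℕ → ℕ → ℤ
  | 0, k => if k = 0 then 1 else 0
  | n + 1, 0 => derangementEulerian n 0 + if n = 0 then -1 else 0
  | n + 1, k + 1 => (k + 2) * derangementEulerian n (k + 1)
      + (n - k) * derangementEulerian n k + if k + 1 = n then (-1) ^ (n + 1) else 0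

/-! ### Inequalities in the triangular array. -/

namespace derangementEulerian

local notation "d" => derangementEulerian

theorem succ_succ (n k : ℕ) : d (n + 1) (k + 1) =
    (k + 2) * d n (k + 1) + (n - k) * d n k + if k + 1 = n then (-1) ^ (n + 1) else 0 := rfl

theorem apply_zero (n : ℕ) : d (n + 1) 0 = 0 := by
  induction n with
  | zero => rfl
  | succ n ih => rw [derangementEulerian, ih]; simp

theorem eq_zero_of_le (n k : ℕ) (h : n + 1 ≤ k) : d (n + 1) k = 0 := by
  induction n generalizing k with
  | zero =>
    obtain ⟨j, rfl⟩ : ∃ j, k = j + 1 := ⟨k - 1, by omega⟩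
    rw [succ_succ]
    rcases j with _ | j <;> simp [derangementEulerian]
  | succ n ih =>
    obtain ⟨j, rfl⟩ : ∃ j, k = j + 1 := ⟨k - 1, by omega⟩
    rw [succ_succ, ih _ (by omega), ih _ (by omega), if_neg (by omega)]
    ring

theorem apply_last (n : ℕ) : d (n + 1) n = if n % 2 = 1 then 1 else 0 := by
  induction n with
  | zero => rfl
  | succ n ih =>
    rw [succ_succ, ih, eq_zero_of_le n _ le_rfl]
    rcases Nat.mod_two_eq_zero_or_one n with h | h
    · simp [h, Nat.add_mod, Even.neg_one_pow (n := n + 1 + 1) (by grind)]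
    · simp [h, Nat.add_mod, Odd.neg_one_pow (n := n + 1 + 1) (by grind)]

/-- The chain `d (2n) (2n-k) < d (2n) k ≤ d (2n) (2n-k-1)` with `k = i + 1`, `n = i + m + 2`, the
second inequality being strict unless `n = 2`. -/
def EvenChain (n : ℕ) : Prop :=
  ∀ i m : ℕ, n = i + m + 2 →
    d (2 * n) (i + 2 * m + 3) < d (2 * n) (i + 1) ∧
    d (2 * n) (i + 1) ≤ d (2 * n) (i + 2 * m + 2) ∧
    (n ≠ 2 → d (2 * n) (i + 1) < d (2 * n) (i + 2 * m + 2))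

/-- The chain `d (2n+1) k < d (2n+1) (2n-k) < d (2n+1) (k+1)` with `k = i + 1`,
`n = i + m + 2`. -/
def OddChain (n : ℕ) : Prop :=
  ∀ i m : ℕ, n = i + m + 2 →
    d (2 * n + 1) (i + 1) < d (2 * n + 1) (i + 2 * m + 3) ∧
    d (2 * n + 1) (i + 2 * m + 3) < d (2 * n + 1) (i + 2)

theorem EvenChain.oddChain {n : ℕ} (h : EvenChain n) : OddChain n := by
  intro i m hn
  obtain ⟨h1, h2, h3⟩ := h i m hn
  have e1 := succ_succ (2 * n) i
  have e2 := succ_succ (2 * n) (i + 2 * m + 2)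
  have e3 := succ_succ (2 * n) (i + 1)
  rw [if_neg (by omega)] at e1 e2 e3
  -- Row 4 contains an equality, so strictness must come from elsewhere when n = 2. There i = 0, and
  -- the boundary entries 0 and 1 supply it.
  have h4 : d (2 * n) i < d (2 * n) (i + 2 * m + 3) ∨
      d (2 * n) i ≤ d (2 * n) (i + 2 * m + 3) ∧ n ≠ 2 := by
    rcases i with _ | i
    · left
      have a := apply_zero (2 * n - 1)
      have b := apply_last (2 * n - 1)
      rw [show 2 * n - 1 + 1 = 2 * n by omega] at a b
      rw [if_pos (by omega), show 2 * n - 1 = 0 + 2 * m + 3 by omega] at b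
      rw [a, b]; norm_num
    · right
      have := (h i (m + 1) (by omega)).2.1
      rw [show i + 2 * (m + 1) + 2 = i + 1 + 2 * m + 3 by ring] at this
      exact ⟨this, by omega⟩
  -- For m = 0 both sides are the same entry.
  have h5 : d (2 * n) (i + 2 * m + 2) ≤ d (2 * n) (i + 2) := by
    rcases m with _ | m
    · simp
    · have := (h (i + 1) m (by omega)).1
      rw [show i + 2 * (m + 1) + 2 = i + 1 + 2 * m + 3 by ring]
      exact this.le
  have hc : ((2 * n : ℕ) : ℤ) = 2 * i + 2 * m + 4 := by rw [hn]; push_cast; ring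
  have ei : (0 : ℤ) ≤ i := by positivity
  have em : (0 : ℤ) ≤ m := by positivity
  rw [hc] at e1 e2 e3
  push_cast at e1 e2 e3
  rw [show i + 2 * m + 3 = i + 2 * m + 2 + 1 by ring, show i + 2 = i + 1 + 1 by ring] at *
  generalize d (2 * n) i = x0 at *
  generalize d (2 * n) (i + 1) = x1 at *
  generalize d (2 * n) (i + 1 + 1) = x2 at *
  generalize d (2 * n) (i + 2 * m + 2) = y2 at *
  generalize d (2 * n) (i + 2 * m + 2 + 1) = y1 at *
  constructor
  · rw [e1, e2]
    rcases h4 with h4 | ⟨h4, h6⟩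
    · linarith [mul_nonneg (by positivity : (0 : ℤ) ≤ i + 2) (sub_nonneg.2 h2),
        mul_pos (by positivity : (0 : ℤ) < i + 2 * m + 4) (sub_pos.2 h4)]
    · linarith [mul_pos (by positivity : (0 : ℤ) < i + 2) (sub_pos.2 (h3 h6)),
        mul_nonneg (by positivity : (0 : ℤ) ≤ i + 2 * m + 4) (sub_nonneg.2 h4)]
  · rw [e2, e3]
    linarith [mul_nonneg (by positivity : (0 : ℤ) ≤ i + 2) (sub_nonneg.2 h5),
        mul_pos (by positivity : (0 : ℤ) < i + 2 * m + 3) (sub_pos.2 h1)]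

/-- The correction term +1 enters only the last entry of the new row, that is, for i = 0. There it
must stay below 2 d_{2n+1,1}, hence the hypothesis `hpos`. -/
theorem OddChain.evenChain {n : ℕ} (h : OddChain n)
    (hpos : 0 < d (2 * n + 1) 1) : EvenChain (n + 1) := by
  intro i m hn
  have hn' : n = i + m + 1 := by omega
  have a := apply_zero (2 * n)
  have b := apply_last (2 * n)
  rw [if_neg (by omega)] at b
  have c := eq_zero_of_le (2 * n) (2 * n + 1) le_rfl
  have e1 := succ_succ (2 * n + 1) i
  have e2 := succ_succ (2 * n + 1) (i + 2 * m + 1)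
  have e3 := succ_succ (2 * n + 1) (i + 2 * m + 2)
  rw [if_neg (by omega)] at e1 e2
  -- the neighbouring entries of the row `2n+1`
  have h1 : d (2 * n + 1) (i + 2 * m + 2) < d (2 * n + 1) (i + 1) := by
    rcases i with _ | i
    · rw [show 0 + 2 * m + 2 = 2 * n by omega, b]; exact hpos
    · have := (h i m (by omega)).2
      rw [show i + 1 + 2 * m + 2 = i + 2 * m + 3 by ring]
      exact this
  have h2 : d (2 * n + 1) i ≤ d (2 * n + 1) (i + 2 * m + 2) ∧
      (1 ≤ i → d (2 * n + 1) i < d (2 * n + 1) (i + 2 * m + 2)) := by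
    rcases i with _ | i
    · rw [show 0 + 2 * m + 2 = 2 * n by omega, a, b]; simp
    · have := (h i m (by omega)).1
      rw [show i + 1 + 2 * m + 2 = i + 2 * m + 3 by ring]
      exact ⟨this.le, fun _ => this⟩
  have h3 : d (2 * n + 1) (i + 1) ≤ d (2 * n + 1) (i + 2 * m + 1) ∧
      (1 ≤ m → d (2 * n + 1) (i + 1) < d (2 * n + 1) (i + 2 * m + 1)) := by
    rcases m with _ | m
    · simp
    · have := (h i m (by omega)).1
      rw [show i + 2 * (m + 1) + 1 = i + 2 * m + 3 by ring]
      exact ⟨this.le, fun _ => this⟩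
  have h4 : d (2 * n + 1) (i + 2 * m + 3) ≤ d (2 * n + 1) i := by
    rcases i with _ | _ | i
    · rw [show 0 + 2 * m + 3 = 2 * n + 1 by omega, a, c]
    · rw [show 0 + 1 + 2 * m + 3 = 2 * n by omega, b]; exact hpos.le
    · have := (h i (m + 1) (by omega)).2
      rw [show i + 1 + 1 + 2 * m + 3 = i + 2 * (m + 1) + 3 by ring]
      exact this.le
  -- This is what remains of the first inequality after removing the multiple i + 2m + 3 of the
  -- difference in `h4`.
  have h5 : (if i + 2 * m + 2 = 2 * n then (-1 : ℤ) ^ (2 * n + 1 + 1) else 0)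
      < d (2 * n + 1) (i + 1) - d (2 * n + 1) (i + 2 * m + 3) +
        (i + 1) * (d (2 * n + 1) (i + 1) - d (2 * n + 1) (i + 2 * m + 2)) := by
    by_cases hi : i = 0
    · subst hi
      rw [if_pos (by omega), Even.neg_one_pow ⟨n + 1, by ring⟩,
        show 0 + 2 * m + 3 = 2 * n + 1 by omega, c, show 0 + 2 * m + 2 = 2 * n by omega, b]
      norm_num
      linarith
    · rw [if_neg (by omega)]
      have : 0 ≤ ((i : ℤ) + 1) * (d (2 * n + 1) (i + 1) - d (2 * n + 1) (i + 2 * m + 2)) :=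
        mul_nonneg (by positivity) (by linarith)
      linarith [h2.2 (by omega)]
  have hc : ((2 * n + 1 : ℕ) : ℤ) = 2 * i + 2 * m + 3 := by rw [hn']; push_cast; ring
  rw [hc] at e1 e2 e3
  push_cast at e1 e2 e3
  rw [show 2 * (n + 1) = 2 * n + 1 + 1 by ring]
  rw [show i + 2 * m + 3 = i + 2 * m + 2 + 1 by ring] at *
  rw [show i + 2 * m + 2 = i + 2 * m + 1 + 1 by ring] at *
  generalize d (2 * n + 1) i = x0 at *
  generalize d (2 * n + 1) (i + 1) = x1 at *
  generalize d (2 * n + 1) (i + 2 * m + 1 + 1 + 1) = y1 at *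
  generalize d (2 * n + 1) (i + 2 * m + 1) = y3 at *
  generalize d (2 * n + 1) (i + 2 * m + 1 + 1) = y2 at *
  refine ⟨?_, ?_, ?_⟩
  · rw [e3, e1]
    linarith [mul_nonneg (by positivity : (0 : ℤ) ≤ i + 2 * m + 3) (sub_nonneg.2 h4)]
  · rw [e1, e2]
    linarith [mul_nonneg (by positivity : (0 : ℤ) ≤ i + 2) (sub_nonneg.2 h3.1),
      mul_nonneg (by positivity : (0 : ℤ) ≤ i + 2 * m + 3) (sub_nonneg.2 h2.1)]
  -- The difference is (i+2)(y3 - x1) + (i+2m+3)(y2 - x0). It vanishes for i = m = 0, which is the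
  -- exception d_{4,1} = d_{4,2}; otherwise one summand is positive.
  · intro hne
    rw [e1, e2]
    rcases Nat.eq_zero_or_pos i with hi | hi
    · linarith [mul_pos (by positivity : (0 : ℤ) < i + 2) (sub_pos.2 (h3.2 (by omega))),
        mul_nonneg (by positivity : (0 : ℤ) ≤ i + 2 * m + 3) (sub_nonneg.2 h2.1)]
    · linarith [mul_nonneg (by positivity : (0 : ℤ) ≤ i + 2) (sub_nonneg.2 h3.1),
        mul_pos (by positivity : (0 : ℤ) < i + 2 * m + 3) (sub_pos.2 (h2.2 hi))]

theorem apply_one_pos (n : ℕ) : 0 < d (n + 2) 1 := by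
  induction n with
  | zero => decide
  | succ n ih =>
    rw [succ_succ (n + 2) 0, if_neg (by omega), apply_zero]
    simp only [Nat.cast_zero, zero_add, mul_zero, add_zero]
    linarith

theorem evenChain (n : ℕ) (hn : 1 ≤ n) : EvenChain n := by
  induction n, hn using Nat.le_induction with
  | base => intro i m h; omega
  | succ n hn ih =>
    refine ih.oddChain.evenChain ?_
    rw [show 2 * n + 1 = (2 * n - 1) + 2 by omega]
    exact apply_one_pos _

theorem oddChain (n : ℕ) (hn : 1 ≤ n) : OddChain n := (evenChain n hn).oddChain

/-- Positivity spreads from index 1 inwards along the chains. It places the peak index n within the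
degree of the polynomial. -/
theorem middle_pos (n : ℕ) (hn : 1 ≤ n) : 0 < d (2 * n) n ∧ 0 < d (2 * n + 1) n := by
  obtain ⟨m, rfl⟩ : ∃ m, n = m + 1 := ⟨n - 1, by omega⟩
  have hp : 0 < d (2 * (m + 1)) 1 := apply_one_pos (2 * m)
  have hp' : 0 < d (2 * (m + 1) + 1) 1 := apply_one_pos (2 * m + 1)
  have key : ∀ i ≤ m, 0 < d (2 * (m + 1)) (i + 1) ∧ 0 < d (2 * (m + 1) + 1) (i + 1) := by
    intro i hi
    induction i with
    | zero => exact ⟨hp, hp'⟩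
    | succ i ih =>
      obtain ⟨h1, h2⟩ := ih (by omega)
      obtain ⟨r, rfl⟩ : ∃ r, m = i + r + 1 := ⟨m - i - 1, by omega⟩
      have a := evenChain _ hn i r (by ring)
      have b := oddChain _ hn i r (by ring)
      refine ⟨?_, by linarith⟩
      rcases r with _ | r
      · have := a.2.1
        rw [show i + 2 * 0 + 2 = i + 1 + 1 by ring] at this
        linarith
      · have c := (evenChain _ hn (i + 1) r (by ring)).1
        have := a.2.1
        rw [show i + 2 * (r + 1) + 2 = i + 1 + 2 * r + 3 by ring] at this
        linarith
  exact key m le_rfl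

end derangementEulerian

/-! ### Words without fixed letters under stable sorting. -/

section Fixed

open Finset

variable {n : ℕ} {α : Type*} [LinearOrder α]

/-- The rank of the position `v` in the stable sorting of the word `w`. -/
def stableRank (w : Fin n → α) (v : Fin n) : ℕ :=
  #{u | w u < w v ∨ w u = w v ∧ u < v}

/-- The number of letters smaller than `a` in the word `w`. -/
def countSmaller (a : α) (w : Fin n → α) : ℕ := #{u | w u < a}

/-- The number of letters different from `a` among the first `v` letters of `w`. -/
def countNePrefix (a : α) (w : Fin n → α) (v : ℕ) : ℕ := #{u : Fin n | (u : ℕ) < v ∧ w u ≠ a}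

theorem stableRank_lt {w : Fin n → α} {u v : Fin n} (h : w u < w v ∨ w u = w v ∧ u < v) :
    stableRank w u < stableRank w v := by
  apply card_lt_card
  rw [Finset.ssubset_iff_of_subset]
  · exact ⟨u, by simpa using h, by simp⟩
  · intro x
    simp only [mem_filter, mem_univ, true_and]
    grind

theorem card_val_lt (v : ℕ) (h : v ≤ n) : #{u : Fin n | (u : ℕ) < v} = v := by
  rw [Fin.card_filter_val_lt]; omega

/-- The equal letters to the left of v count towards both the rank and the position, so they cancel.
The remaining condition ignores occurrences of the letter itself, so inserting another copy does not
disturb it. -/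
theorem stableRank_eq_iff (w : Fin n → α) (v : Fin n) :
    stableRank w v = v ↔ countNePrefix (w v) w v = countSmaller (w v) w := by
  have h1 : stableRank w v = countSmaller (w v) w + #{u | w u = w v ∧ u < v} := by
    rw [stableRank, filter_or, card_union_of_disjoint, countSmaller]
    rw [disjoint_filter]; intro x; grind
  have h2 : #{u : Fin n | (u : ℕ) < v} =
      #{u | w u = w v ∧ u < v} + countNePrefix (w v) w v := by
    rw [countNePrefix, ← card_union_of_disjoint, ← filter_or]
    · congr 1; ext u; simp only [mem_filter, mem_univ, true_and, Fin.lt_def]; tauto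
    · rw [disjoint_filter]; rintro x - ⟨h, -⟩ ⟨-, h'⟩; exact h' h
  rw [card_val_lt _ v.2.le] at h2
  omega

theorem countSmaller_insertNth (w : Fin n → α) (a : α) (f : Fin (n + 1)) :
    countSmaller a (f.insertNth a w : Fin (n + 1) → α) = countSmaller a w := by
  simp [countSmaller, card_filter, -sum_boole, Fin.sum_univ_succAbove _ f]

theorem succAbove_val_lt_iff {f : Fin (n + 1)} {u : Fin n} {v : ℕ} (h : v ≤ f) :
    (f.succAbove u : ℕ) < v ↔ (u : ℕ) < v := by
  rw [Fin.succAbove]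
  split_ifs with h1
  · simp
  · simp only [Fin.lt_def, Fin.val_castSucc, not_lt] at h1
    simp only [Fin.val_succ]
    omega

theorem countNePrefix_insertNth (w : Fin n → α) (a : α) (f : Fin (n + 1)) (v : ℕ)
    (h : v ≤ f) :
    countNePrefix a (f.insertNth a w : Fin (n + 1) → α) v = countNePrefix a w v := by
  simp [countNePrefix, card_filter, -sum_boole, Fin.sum_univ_succAbove _ f, succAbove_val_lt_iff h]

theorem countNePrefix_mono (a : α) (w : Fin n → α) {u v : ℕ} (h : u ≤ v) :
    countNePrefix a w u ≤ countNePrefix a w v := by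
  apply card_le_card
  intro x
  simp only [mem_filter, mem_univ, true_and]
  rintro ⟨h1, h2⟩
  exact ⟨by omega, h2⟩

theorem countNePrefix_zero (a : α) (w : Fin n → α) : countNePrefix a w 0 = 0 := by
  simp [countNePrefix]

theorem countNePrefix_succ (a : α) (w : Fin n → α) (v : Fin n) :
    countNePrefix a w (v + 1) = countNePrefix a w v + if w v = a then 0 else 1 := by
  have : (univ.filter fun u : Fin n => (u : ℕ) < v + 1 ∧ w u ≠ a) =
      (univ.filter fun u : Fin n => (u : ℕ) < v ∧ w u ≠ a) ∪ univ.filter fun u : Fin n => u = v ∧ w u ≠ a := by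
    rw [← filter_or]
    ext u
    simp only [mem_filter, mem_univ, true_and, Fin.ext_iff]
    have : (u : ℕ) < v + 1 ↔ (u : ℕ) < v ∨ (u : ℕ) = v := by omega
    rw [this]; tauto
  rw [countNePrefix, this, card_union_of_disjoint, countNePrefix]
  · congr 1
    split_ifs with h
    · rw [card_eq_zero, filter_eq_empty_iff]
      rintro x - ⟨rfl, h'⟩
      exact h' h
    · rw [card_eq_one]
      exact ⟨v, by ext u; simp only [mem_filter, mem_univ, true_and, mem_singleton]; grind⟩
  · rw [disjoint_filter]
    rintro x - ⟨h, -⟩ ⟨rfl, -⟩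
    omega

theorem countNePrefix_of_le (a : α) (w : Fin n → α) {v : ℕ} (h : n ≤ v) :
    countNePrefix a w (v + 1) = countNePrefix a w v := by
  simp only [countNePrefix]
  congr 1; ext u
  have := u.2
  simp only [mem_filter, mem_univ, true_and]
  constructor <;> rintro ⟨-, h'⟩ <;> exact ⟨by omega, h'⟩

theorem countNePrefix_succ_le (a : α) (w : Fin n → α) (v : ℕ) :
    countNePrefix a w (v + 1) ≤ countNePrefix a w v + 1 := by
  by_cases h : v < n
  · have := countNePrefix_succ a w ⟨v, h⟩
    simp only at this
    rw [this]; split_ifs <;> omega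
  · rw [countNePrefix_of_le a w (by omega)]; omega

theorem countSmaller_le_countNePrefix (a : α) (w : Fin n → α) :
    countSmaller a w ≤ countNePrefix a w n := by
  apply card_le_card
  intro x
  simp only [mem_filter, mem_univ, true_and]
  exact fun h => ⟨x.2, h.ne⟩

theorem exists_countSmaller_le (a : α) (w : Fin n → α) :
    ∃ v, countSmaller a w ≤ countNePrefix a w v := ⟨n, countSmaller_le_countNePrefix a w⟩

/-- The leftmost place where the letter `a` can be inserted into `w` as a fixed point of the
stable sorting. -/
noncomputable def fixedGap (a : α) (w : Fin n → α) : Fin (n + 1) :=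
  ⟨Nat.find (exists_countSmaller_le a w),
    Nat.lt_succ_of_le (Nat.find_min' _ (countSmaller_le_countNePrefix a w))⟩

theorem countNePrefix_lt {a : α} {w : Fin n → α} {v : ℕ} (h : v < fixedGap a w) :
    countNePrefix a w v < countSmaller a w :=
  not_le.1 (Nat.find_min (exists_countSmaller_le a w) h)

theorem fixedGap_le {a : α} {w : Fin n → α} {v : ℕ}
    (h : countSmaller a w ≤ countNePrefix a w v) : (fixedGap a w : ℕ) ≤ v :=
  Nat.find_min' (exists_countSmaller_le a w) h

/-- The prefix count starts at 0 and grows by at most 1 per step, so it cannot jump over the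
threshold. -/
theorem countNePrefix_fixedGap (a : α) (w : Fin n → α) :
    countNePrefix a w (fixedGap a w) = countSmaller a w := by
  refine le_antisymm ?_ (Nat.find_spec (exists_countSmaller_le a w))
  change countNePrefix a w (fixedGap a w : ℕ) ≤ _
  rcases Nat.eq_zero_or_pos (fixedGap a w : ℕ) with h | h
  · rw [h, countNePrefix_zero]; exact Nat.zero_le _
  · obtain ⟨v, hv⟩ : ∃ v, (fixedGap a w : ℕ) = v + 1 := ⟨_, (Nat.succ_pred_eq_of_pos h).symm⟩
    have h1 := countNePrefix_lt (a := a) (w := w) (v := v) (by omega)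
    have h2 := countNePrefix_succ_le a w v
    rw [hv]; omega

/-- The word `w` has an occurrence of the letter `a` that is fixed by the stable sorting. -/
def HasFixedLetter (w : Fin n → α) (a : α) : Prop := ∃ v, w v = a ∧ stableRank w v = v

/-- Insertion of the letter `a` into `w` as a fixed point. -/
noncomputable def insertFixed (a : α) (w : Fin n → α) : Fin (n + 1) → α :=
  (fixedGap a w).insertNth a w

theorem insertFixed_fixedGap (a : α) (w : Fin n → α) : insertFixed a w (fixedGap a w) = a := by
  simp [insertFixed]

theorem stableRank_insertFixed (a : α) (w : Fin n → α) :
    stableRank (insertFixed a w) (fixedGap a w) = fixedGap a w := by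
  rw [stableRank_eq_iff, insertFixed_fixedGap, insertFixed, countSmaller_insertNth,
    countNePrefix_insertNth _ _ _ _ le_rfl, countNePrefix_fixedGap]

theorem hasFixedLetter_insertFixed (a : α) (w : Fin n → α) : HasFixedLetter (insertFixed a w) a :=
  ⟨_, insertFixed_fixedGap a w, stableRank_insertFixed a w⟩

/-- The insertion place can be read off the resulting word: if it were further right for one
preimage, the prefix count at the earlier place would be both equal to and below the threshold. -/
theorem insertFixed_injective (a : α) :
    Function.Injective (insertFixed a : (Fin n → α) → Fin (n + 1) → α) := by
  have aux : ∀ w₁ w₂ : Fin n → α, insertFixed a w₁ = insertFixed a w₂ →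
      fixedGap a w₂ ≤ fixedGap a w₁ := by
    intro w₁ w₂ h
    by_contra! hlt
    rw [Fin.lt_def] at hlt
    have h1 := countNePrefix_lt hlt
    rw [← countSmaller_insertNth w₂ a (fixedGap a w₂),
      ← countNePrefix_insertNth w₂ a (fixedGap a w₂) _ hlt.le] at h1
    change countNePrefix a (insertFixed a w₂) _ < countSmaller a (insertFixed a w₂) at h1
    rw [← h, insertFixed, countSmaller_insertNth, countNePrefix_insertNth _ _ _ _ le_rfl,
      countNePrefix_fixedGap] at h1
    exact lt_irrefl _ h1
  intro w₁ w₂ h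
  have hg : fixedGap a w₁ = fixedGap a w₂ := le_antisymm (aux _ _ h.symm) (aux _ _ h)
  rw [insertFixed, insertFixed, hg] at h
  exact (Fin.insertNth_injective2 h).2

/-- Delete the leftmost fixed occurrence of `a`. Were the gap of the shorter word further left, its
letter in `w` would differ from `a` by minimality, and the prefix count would exceed the threshold
before reaching v. -/
theorem exists_insertFixed_eq {a : α} {w : Fin (n + 1) → α} (h : HasFixedLetter w a) :
    ∃ w', insertFixed a w' = w := by
  classical
  have hex : ∃ v : ℕ, ∃ h : v < n + 1, w ⟨v, h⟩ = a ∧ countNePrefix a w v = countSmaller a w := by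
    obtain ⟨v, rfl, hv⟩ := h
    exact ⟨v, v.2, rfl, (stableRank_eq_iff w v).1 hv⟩
  obtain ⟨hv, hva, hvc⟩ := Nat.find_spec hex
  have hmin := fun u => Nat.find_min hex (m := u)
  generalize Nat.find hex = v at hv hva hvc hmin
  set f : Fin (n + 1) := ⟨v, hv⟩
  have hw : w = (f.insertNth a (f.removeNth w) : Fin (n + 1) → α) := by
    rw [← hva]; exact (Fin.insertNth_self_removeNth f w).symm
  generalize f.removeNth w = w' at hw
  refine ⟨w', ?_⟩
  suffices fixedGap a w' = f by rw [insertFixed, this, ← hw]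
  rw [hw, countSmaller_insertNth, countNePrefix_insertNth _ _ _ _ le_rfl] at hvc
  have hle : (fixedGap a w' : ℕ) ≤ v := fixedGap_le hvc.ge
  refine Fin.ext (le_antisymm hle ?_)
  by_contra! hlt
  change (fixedGap a w' : ℕ) < v at hlt
  have hc := countNePrefix_fixedGap a w'
  have hc' : countNePrefix a w (fixedGap a w' : ℕ) = countSmaller a w := by
    rw [hw, countSmaller_insertNth, countNePrefix_insertNth _ _ _ _ hle, hc]
  refine hmin _ hlt ⟨by omega, ?_, hc'⟩
  by_contra hne
  have h1 := countNePrefix_succ a w ⟨fixedGap a w', by omega⟩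
  rw [if_neg hne] at h1
  have h2 := countNePrefix_mono a w (show (fixedGap a w' : ℕ) + 1 ≤ v from hlt)
  have h3 : countNePrefix a w v = countSmaller a w := by
    rw [hw, countSmaller_insertNth, countNePrefix_insertNth _ _ _ _ le_rfl, hvc]
  simp only at h1
  omega

theorem stableRank_insertNth (w : Fin n → α) (a : α) (f : Fin (n + 1)) (u : Fin n) :
    stableRank (f.insertNth a w : Fin (n + 1) → α) (f.succAbove u) =
      (if a < w u ∨ a = w u ∧ f < f.succAbove u then 1 else 0) + stableRank w u := by
  simp [stableRank, card_filter, -sum_boole, Fin.sum_univ_succAbove _ f, Fin.succAbove_lt_succAbove_iff]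

/-- Insertion at f raises the rank of u if the new letter sorts before it, and the index of u if f
lies to its left. If only one of the two rises, rank and index lie on opposite sides of f, and u is
fixed neither before nor after. -/
theorem stableRank_insertNth_eq_iff (w : Fin n → α) (a : α) (f : Fin (n + 1)) (u : Fin n)
    (hf : stableRank (f.insertNth a w : Fin (n + 1) → α) f = f) :
    stableRank (f.insertNth a w : Fin (n + 1) → α) (f.succAbove u) = (f.succAbove u : ℕ) ↔
      stableRank w u = u := by
  have h1 := stableRank_insertNth w a f u
  have h2 : (u : ℕ) < f ∧ (f.succAbove u : ℕ) = u ∨ (f : ℕ) ≤ u ∧ (f.succAbove u : ℕ) = u + 1 := by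
    rw [Fin.succAbove]
    split_ifs with h <;> simp only [Fin.lt_def, Fin.val_castSucc] at h
    · left; exact ⟨h, rfl⟩
    · right; exact ⟨by omega, rfl⟩
  by_cases h : a < w u ∨ a = w u ∧ f < f.succAbove u
  · rw [if_pos h] at h1
    have h3 := stableRank_lt (w := (f.insertNth a w : Fin (n + 1) → α)) (u := f)
      (v := f.succAbove u) (by simpa using h)
    omega
  · rw [if_neg h] at h1
    have h3 := stableRank_lt (w := (f.insertNth a w : Fin (n + 1) → α)) (v := f)
      (u := f.succAbove u) (by
        have := Fin.succAbove_ne f u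
        simp only [Fin.insertNth_apply_succAbove, Fin.insertNth_apply_same]
        grind)
    omega

theorem hasFixedLetter_insertFixed_iff {a b : α} (hab : b ≠ a) (w : Fin n → α) :
    HasFixedLetter (insertFixed a w) b ↔ HasFixedLetter w b := by
  have h := fun u => stableRank_insertNth_eq_iff w a (fixedGap a w) u (stableRank_insertFixed a w)
  simp only [HasFixedLetter, Fin.exists_iff_succAbove (fixedGap a w), insertFixed, h,
    Fin.insertNth_apply_succAbove, Fin.insertNth_apply_same, hab.symm, false_and, false_or]

open Classical in
/-- The number of words without a fixed occurrence of a letter from `J`. -/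
noncomputable def cardNoFixed [Fintype α] (n : ℕ) (J : Finset α) : ℕ :=
  #{w : Fin n → α | ∀ b ∈ J, ¬ HasFixedLetter w b}

variable [Fintype α]

theorem cardNoFixed_empty (n : ℕ) :
    cardNoFixed n (∅ : Finset α) = Fintype.card α ^ n := by
  simp [cardNoFixed]

theorem cardNoFixed_zero (J : Finset α) : cardNoFixed 0 J = 1 := by
  simp [cardNoFixed, HasFixedLetter]

/-- Words of length n + 1 avoiding fixed letters from J either avoid a fixed `a` as well, or arise
uniquely by `insertFixed` from words of length n, which leaves the condition on J unchanged. -/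
theorem cardNoFixed_insert (n : ℕ) {J : Finset α} {a : α} (ha : a ∉ J) :
    cardNoFixed (n + 1) J = cardNoFixed (n + 1) (insert a J) + cardNoFixed n J := by
  classical
  have h : cardNoFixed n J =
      #{w : Fin (n + 1) → α | (∀ b ∈ J, ¬ HasFixedLetter w b) ∧ HasFixedLetter w a} := by
    rw [cardNoFixed, ← card_map ⟨insertFixed a, insertFixed_injective a⟩]
    congr 1
    ext w
    simp only [mem_map, mem_filter, mem_univ, true_and, Function.Embedding.coeFn_mk]
    have hne : ∀ b ∈ J, b ≠ a := fun b hb h => ha (h ▸ hb)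
    constructor
    · rintro ⟨w, hw, rfl⟩
      exact ⟨fun b hb => by rw [hasFixedLetter_insertFixed_iff (hne b hb)]; exact hw b hb,
        hasFixedLetter_insertFixed a w⟩
    · rintro ⟨h1, h2⟩
      obtain ⟨w, rfl⟩ := exists_insertFixed_eq h2
      exact ⟨w, fun b hb => by rw [← hasFixedLetter_insertFixed_iff (hne b hb)]; exact h1 b hb, rfl⟩
  rw [h, cardNoFixed, cardNoFixed, ← card_union_of_disjoint, ← filter_or]
  · congr 1; ext w; simp only [mem_filter, mem_univ, true_and, forall_mem_insert]; tauto
  · rw [disjoint_filter]; simp only [forall_mem_insert]; tauto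

/-- Each letter added to J multiplies the generating function in the length by 1 - x, giving
(1-x)^{#J} / (1-mx) with m the size of the alphabet. The induction on J is this computation on
coefficients, with Pascal's rule. -/
theorem cardNoFixed_succ (n : ℕ) (J : Finset α) :
    (cardNoFixed (n + 1) J : ℤ) = Fintype.card α * cardNoFixed n J
      + (-1) ^ (n + 1) * (#J).choose (n + 1) := by
  classical
  induction J using Finset.induction_on generalizing n with
  | empty => rw [cardNoFixed_empty, cardNoFixed_empty]; push_cast; simp; ring
  | insert a J ha ih =>
    rw [card_insert_of_notMem ha, Nat.choose_succ_succ]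
    have h1 := cardNoFixed_insert n ha
    have h2 := ih n
    zify at h1
    rcases n with _ | n
    · simp only [cardNoFixed_zero] at *
      simp at h2 h1 ⊢
      linarith
    · have h3 := cardNoFixed_insert n ha
      have h4 := ih n
      zify at h3
      have h5 : (cardNoFixed (n + 1) (insert a J) : ℤ) = cardNoFixed (n + 1) J - cardNoFixed n J := by
        linarith
      rw [h5]
      push_cast
      rw [mul_sub, pow_succ (-1 : ℤ) (n + 1), ← sub_eq_zero]
      have : (cardNoFixed (n + 1 + 1) (insert a J) : ℤ) =
        cardNoFixed (n + 1 + 1) J - cardNoFixed (n + 1) J := by linarith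
      rw [this, h2, pow_succ (-1 : ℤ) (n + 1)]
      linear_combination -h4

end Fixed

/-! ### Words grouped by their sorting permutation. -/

section Sorting

open Finset

theorem sort_eq_iff_strictMono {n : ℕ} {α : Type*} [LinearOrder α] (w : Fin n → α)
    (π : Equiv.Perm (Fin n)) :
    Tuple.sort w = π ↔ StrictMono fun i => toLex (w (π i), π i) := by
  rw [eq_comm, Tuple.eq_sort_iff']
  rfl

theorem stableRank_sort {n : ℕ} {α : Type*} [LinearOrder α] (w : Fin n → α) (i : Fin n) :
    stableRank w (Tuple.sort w i) = i := by
  have h := (sort_eq_iff_strictMono w _).1 rfl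
  suffices (univ.filter fun u => w u < w (Tuple.sort w i) ∨
      w u = w (Tuple.sort w i) ∧ u < Tuple.sort w i) =
      (univ.filter fun j : Fin n => (j : ℕ) < i).map (Tuple.sort w).toEmbedding by
    rw [stableRank, this, card_map, card_val_lt _ i.2.le]
  ext u
  obtain ⟨j, rfl⟩ := (Tuple.sort w).surjective u
  have := h.lt_iff_lt (a := j) (b := i)
  rw [Prod.Lex.toLex_lt_toLex] at this
  simpa using this

theorem sort_apply_eq_self_iff {n : ℕ} {α : Type*} [LinearOrder α] (w : Fin n → α) (v : Fin n) :
    Tuple.sort w v = v ↔ stableRank w v = v := by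
  obtain ⟨i, rfl⟩ := (Tuple.sort w).surjective v
  rw [stableRank_sort, (Tuple.sort w).injective.eq_iff, Fin.ext_iff, eq_comm]

theorem sort_mem_derangements_iff {n : ℕ} {α : Type*} [LinearOrder α] (w : Fin n → α) :
    Tuple.sort w ∈ derangements (Fin n) ↔ ∀ a, ¬ HasFixedLetter w a := by
  simp only [derangements, Set.mem_ofPred_eq, HasFixedLetter, ne_eq, sort_apply_eq_self_iff]
  grind

variable {n : ℕ}

/-- The number of ascents of `π` to the left of the position `i`. -/
def ascentsBefore (π : Equiv.Perm (Fin (n + 1))) (i : Fin (n + 1)) : ℕ :=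
  #{j : Fin n | (j : ℕ) < i ∧ π j.castSucc < π j.succ}

theorem ascentsBefore_zero (π : Equiv.Perm (Fin (n + 1))) : ascentsBefore π 0 = 0 := by
  simp [ascentsBefore]

theorem ascentsBefore_succ (π : Equiv.Perm (Fin (n + 1))) (i : Fin n) :
    ascentsBefore π i.succ =
      ascentsBefore π i.castSucc + if π i.castSucc < π i.succ then 1 else 0 := by
  have : (univ.filter fun j : Fin n => (j : ℕ) < i.succ ∧ π j.castSucc < π j.succ) =
      (univ.filter fun j : Fin n => (j : ℕ) < i.castSucc ∧ π j.castSucc < π j.succ) ∪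
        univ.filter fun j : Fin n => j = i ∧ π j.castSucc < π j.succ := by
    rw [← filter_or]
    ext j
    simp only [mem_filter, mem_univ, true_and, Fin.ext_iff, Fin.val_succ, Fin.val_castSucc]
    have : (j : ℕ) < i + 1 ↔ (j : ℕ) < i ∨ (j : ℕ) = i := by omega
    rw [this]; tauto
  rw [ascentsBefore, this, card_union_of_disjoint, ascentsBefore]
  · congr 1
    split_ifs with h
    · rw [card_eq_one]
      exact ⟨i, by ext u; simp only [mem_filter, mem_univ, true_and, mem_singleton]; grind⟩
    · rw [card_eq_zero, filter_eq_empty_iff]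
      rintro x - ⟨rfl, h'⟩
      exact h h'
  · rw [disjoint_filter]
    rintro x - ⟨h, -⟩ ⟨rfl, -⟩
    simp at h

theorem ascentsBefore_last_add_descentNumber (π : Equiv.Perm (Fin (n + 1))) :
    ascentsBefore π (Fin.last n) + descentNumber π = n := by
  have h1 : descentNumber π = #{j : Fin n | ¬ π j.castSucc < π j.succ} := by
    rw [descentNumber]
    suffices (univ.filter fun i : Fin (n + 1) =>
        ∃ h : (i : ℕ) + 1 < n + 1, π ⟨(i : ℕ) + 1, h⟩ < π i) =
        (univ.filter fun j : Fin n => ¬ π j.castSucc < π j.succ).map Fin.castSuccEmb by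
      rw [this, card_map]
    ext i
    simp only [mem_filter, mem_univ, true_and, mem_map, Fin.castSuccEmb_apply, not_lt]
    constructor
    · rintro ⟨h, hi⟩
      exact ⟨⟨i, by omega⟩, hi.le, rfl⟩
    · rintro ⟨j, hj, rfl⟩
      exact ⟨by simp, lt_of_le_of_ne hj (π.injective.ne (by simp [Fin.ext_iff]))⟩
  have h2 : ascentsBefore π (Fin.last n) = #{j : Fin n | π j.castSucc < π j.succ} := by
    simp [ascentsBefore]
  rw [h1, h2, card_filter_add_card_filter_not]
  simp

theorem ascentsBefore_le_last (π : Equiv.Perm (Fin (n + 1))) (i : Fin (n + 1)) :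
    ascentsBefore π i ≤ ascentsBefore π (Fin.last n) := by
  apply card_le_card
  intro x
  simp only [mem_filter, mem_univ, true_and]
  rintro ⟨-, h⟩
  exact ⟨x.2, h⟩

theorem descentNumber_le (π : Equiv.Perm (Fin (n + 1))) : descentNumber π ≤ n := by
  have := ascentsBefore_last_add_descentNumber π
  omega

theorem sort_eq_iff {α : Type*} [LinearOrder α] (w : Fin (n + 1) → α)
    (π : Equiv.Perm (Fin (n + 1))) :
    Tuple.sort w = π ↔ ∀ i : Fin n, w (π i.castSucc) < w (π i.succ) ∨
      w (π i.castSucc) = w (π i.succ) ∧ π i.castSucc < π i.succ := by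
  simp only [sort_eq_iff_strictMono, Fin.strictMono_iff_lt_succ, Prod.Lex.toLex_lt_toLex]

theorem card_orderEmbedding_fin (k N : ℕ) : Fintype.card (Fin k ↪o Fin N) = N.choose k := by
  rw [← Nat.card_eq_fintype_card, Nat.card_congr Set.powersetCard.ofFinEmbEquiv,
    Set.powersetCard.card, Nat.card_fin]

/-- Read in the order π, such a word increases weakly at ascents of π and strictly at descents.
Adding the number of preceding ascents makes it strictly increasing throughout, with values below m
+ (number of ascents) = m + n - des π. -/
theorem card_sort_eq (π : Equiv.Perm (Fin (n + 1))) (m : ℕ) :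
    #{w : Fin (n + 1) → Fin m | Tuple.sort w = π} =
      (m + n - descentNumber π).choose (n + 1) := by
  have hd := ascentsBefore_last_add_descentNumber π
  rw [← card_orderEmbedding_fin, ← card_univ]
  have hval : ∀ w : Fin (n + 1) → Fin m, ∀ i,
      (w (π i) : ℕ) + ascentsBefore π i < m + n - descentNumber π := fun w i => by
    have := (w (π i)).2
    have := ascentsBefore_le_last π i
    omega
  refine card_bij (fun w hw => OrderEmbedding.ofStrictMono
    (fun i => ⟨(w (π i) : ℕ) + ascentsBefore π i, hval w i⟩) ?_) (fun _ _ => mem_univ _) ?_ ?_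
  · rw [Fin.strictMono_iff_lt_succ]
    intro i
    have h := (sort_eq_iff w π).1 (by simpa using hw) i
    rw [Fin.lt_def]
    simp only [ascentsBefore_succ]
    rcases h with h | ⟨h, h'⟩
    · have := Fin.lt_def.1 h
      omega
    · rw [h, if_pos h']; omega
  · intro w₁ _ w₂ _ h
    funext x
    obtain ⟨i, rfl⟩ := π.surjective x
    have := congrArg Fin.val (DFunLike.congr_fun h i)
    simp only [OrderEmbedding.coe_ofStrictMono] at this
    exact Fin.ext (by omega)
  · intro t _
    have hstep : ∀ i : Fin n, (t i.castSucc : ℕ) < t i.succ := fun i =>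
      t.strictMono Fin.castSucc_lt_succ
    have hge : ∀ i, ascentsBefore π i ≤ t i := by
      intro i
      induction i using Fin.induction with
      | zero => rw [ascentsBefore_zero]; exact Nat.zero_le _
      | succ i ih =>
        have := hstep i
        rw [ascentsBefore_succ]; split_ifs <;> omega
    have hmono : Monotone fun i => (t i : ℕ) - ascentsBefore π i := by
      rw [Fin.monotone_iff_le_succ]
      intro i
      have := hstep i
      simp only [ascentsBefore_succ]; split_ifs <;> omega
    have hlt : ∀ i, (t i : ℕ) - ascentsBefore π i < m := by
      intro i
      have h1 := hmono (Fin.le_last i)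
      have h2 := (t (Fin.last n)).2
      have h3 := hge (Fin.last n)
      simp only at h1
      omega
    refine ⟨fun x => ⟨(t (π.symm x) : ℕ) - ascentsBefore π (π.symm x), hlt _⟩, ?_, ?_⟩
    · rw [mem_filter, sort_eq_iff]
      refine ⟨mem_univ _, fun i => ?_⟩
      have h1 := hstep i
      have h2 := hge i.castSucc
      have h3 := hge i.succ
      have h4 := ascentsBefore_succ π i
      simp only [Equiv.symm_apply_apply, Fin.lt_def, Fin.ext_iff]
      by_cases h : π i.castSucc < π i.succ
      · rw [if_pos h] at h4
        rw [Fin.lt_def] at h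
        omega
      · rw [if_neg h] at h4
        omega
    · ext i
      have := hge i
      simp only [OrderEmbedding.coe_ofStrictMono, Equiv.symm_apply_apply]
      omega

theorem cardNoFixed_univ_eq_sum_derangements (n m : ℕ) :
    cardNoFixed (n + 1) (univ : Finset (Fin m)) =
      ∑ π : derangements (Fin (n + 1)),
        (m + n - descentNumber (π : Equiv.Perm (Fin (n + 1)))).choose (n + 1) := by
  classical
  rw [cardNoFixed, card_eq_sum_card_fiberwise (t := (derangements (Fin (n + 1))).toFinset)
    (f := Tuple.sort)]
  · rw [Finset.sum_subtype (p := (· ∈ derangements (Fin (n + 1)))) _ (by simp)]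
    refine Fintype.sum_congr _ _ fun π => ?_
    rw [← card_sort_eq, filter_filter]
    congr 1
    ext w
    simp only [mem_filter, mem_univ, true_and, forall_const, ← sort_mem_derangements_iff,
      and_iff_right_iff_imp]
    intro h
    rw [h]; exact π.2
  · intro w
    simp [sort_mem_derangements_iff]

end Sorting

/-! ### Worpitzky-type identity and identification of the coefficients. -/

open Finset in
theorem coeff_derangementDescentPoly (n k : ℕ) :
    (derangementDescentPoly n).coeff k =
      ∑ π : derangements (Fin n),
        if descentNumber (π : Equiv.Perm (Fin n)) = k then (1 : ℤ) else 0 := by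
  simp only [derangementDescentPoly, finsetSum_coeff, coeff_X_pow, eq_comm]

theorem coeff_derangementDescentPoly_of_lt {n k : ℕ} (h : n < k) :
    (derangementDescentPoly (n + 1)).coeff k = 0 := by
  rw [coeff_derangementDescentPoly]
  refine Finset.sum_eq_zero fun π _ => if_neg ?_
  have := descentNumber_le (π : Equiv.Perm (Fin (n + 1)))
  omega

theorem coeff_derangementDescentPoly_nonneg (n k : ℕ) :
    0 ≤ (derangementDescentPoly n).coeff k := by
  rw [coeff_derangementDescentPoly]
  refine Finset.sum_nonneg fun π _ => ?_
  split_ifs <;> simp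

theorem sum_coeff_mul_choose (n m : ℕ) :
    ∑ k ∈ Finset.range (n + 1),
      (derangementDescentPoly (n + 1)).coeff k * ((m + n - k).choose (n + 1) : ℤ) =
      cardNoFixed (n + 1) (Finset.univ : Finset (Fin m)) := by
  rw [cardNoFixed_univ_eq_sum_derangements]
  simp only [coeff_derangementDescentPoly, Finset.sum_mul, ite_mul, one_mul, zero_mul]
  rw [Finset.sum_comm]
  push_cast
  refine Finset.sum_congr rfl fun π _ => ?_
  have := descentNumber_le (π : Equiv.Perm (Fin (n + 1)))
  rw [Finset.sum_ite_eq, if_pos (by simp; omega)]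

theorem worpitzky_step (n m k : ℕ) (hk : k ≤ n) :
    (m : ℤ) * ((m + n - k).choose (n + 1) : ℤ) =
      (k + 1) * ((m + (n + 1) - k).choose (n + 2) : ℤ) +
        (n + 1 - k) * ((m + (n + 1) - (k + 1)).choose (n + 2) : ℤ) := by
  obtain ⟨j, rfl⟩ := Nat.exists_eq_add_of_le hk
  rw [show m + (k + j) - k = m + j by omega, show m + (k + j + 1) - k = m + j + 1 by omega,
    show m + (k + j + 1) - (k + 1) = m + j by omega, Nat.choose_succ_succ]
  have h : ((m + j).choose (k + j + 1 + 1) : ℤ) * (k + j + 2) =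
      (m + j).choose (k + j + 1) * ((m : ℤ) - k - 1) := by
    have := Nat.choose_succ_right_eq (m + j) (k + j + 1)
    rcases le_or_gt (k + j + 1) (m + j) with h | h
    · zify [h] at this
      linear_combination this
    · rw [Nat.choose_eq_zero_of_lt h, Nat.choose_eq_zero_of_lt (by omega)]; simp
  push_cast
  linear_combination -h

open derangementEulerian in
theorem sum_derangementEulerian_mul_choose (n m : ℕ) :
    ∑ k ∈ Finset.range (n + 1),
      derangementEulerian (n + 1) k * ((m + n - k).choose (n + 1) : ℤ) =
      cardNoFixed (n + 1) (Finset.univ : Finset (Fin m)) := by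
  induction n with
  | zero =>
    rw [cardNoFixed_succ, cardNoFixed_zero]
    simp [apply_zero]
  | succ n ih =>
    rw [cardNoFixed_succ, ← ih, Finset.sum_range_succ', apply_zero, zero_mul, add_zero]
    have hsplit : ∀ x y z u : ℤ, (x + y + z) * u = x * u + y * u + z * u := fun _ _ _ _ => by ring
    simp only [succ_succ (n + 1), hsplit, Finset.sum_add_distrib, Fintype.card_fin,
      Finset.card_univ, Finset.mul_sum]
    have hlast : ∑ k ∈ Finset.range (n + 1),
        (if k + 1 = n + 1 then (-1 : ℤ) ^ (n + 1 + 1) else 0) *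
          ((m + (n + 1) - (k + 1)).choose (n + 1 + 1) : ℤ) =
        (-1) ^ (n + 1 + 1) * (m.choose (n + 1 + 1) : ℤ) := by
      rw [Finset.sum_eq_single n]
      · rw [if_pos rfl, Nat.add_sub_cancel]
      · intro k _ hk; rw [if_neg (by omega), zero_mul]
      · intro h; simp at h
    -- The reindexing is free because the entries of row n + 1 at both ends, 0 and n + 1, vanish.
    have hshift : ∑ k ∈ Finset.range (n + 1), ((k : ℤ) + 2) * derangementEulerian (n + 1) (k + 1) *
          ((m + (n + 1) - (k + 1)).choose (n + 1 + 1) : ℤ) =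
        ∑ k ∈ Finset.range (n + 1), ((k : ℤ) + 1) * derangementEulerian (n + 1) k *
          ((m + (n + 1) - k).choose (n + 1 + 1) : ℤ) := by
      have h1 := Finset.sum_range_succ (fun k : ℕ => ((k : ℤ) + 1) * derangementEulerian (n + 1) k *
          ((m + (n + 1) - k).choose (n + 1 + 1) : ℤ)) (n + 1)
      have h2 := Finset.sum_range_succ' (fun k : ℕ => ((k : ℤ) + 1) * derangementEulerian (n + 1) k *
          ((m + (n + 1) - k).choose (n + 1 + 1) : ℤ)) (n + 1)
      rw [h1, eq_zero_of_le n _ le_rfl, apply_zero] at h2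
      simp only [mul_zero, zero_mul, add_zero] at h2
      rw [h2]
      refine Finset.sum_congr rfl fun k _ => ?_
      push_cast; ring
    rw [hlast, hshift, ← Finset.sum_add_distrib]
    congr 1
    refine Finset.sum_congr rfl fun k hk => ?_
    have := worpitzky_step n m k (by simpa [Nat.lt_succ_iff] using hk)
    push_cast
    linear_combination -derangementEulerian (n + 1) k * this

/-- The system is unitriangular: at m = k + 1 the binomial coefficient is 1 at index k and 0 at
every larger index. -/
theorem eq_of_sum_mul_choose_eq {n : ℕ} {a b : ℕ → ℤ}
    (h : ∀ m, ∑ k ∈ Finset.range (n + 1), a k * ((m + n - k).choose (n + 1) : ℤ) =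
      ∑ k ∈ Finset.range (n + 1), b k * ((m + n - k).choose (n + 1) : ℤ))
    (k : ℕ) (hk : k ≤ n) : a k = b k := by
  induction k using Nat.strong_induction_on with
  | _ k ih =>
    have h1 := h (k + 1)
    rw [← sub_eq_zero, ← Finset.sum_sub_distrib, Finset.sum_eq_single k] at h1
    · rw [show k + 1 + n - k = n + 1 by omega, Nat.choose_self] at h1
      simpa [sub_eq_zero] using h1
    · intro j hj hjk
      rcases lt_or_gt_of_ne hjk with hlt | hlt
      · rw [ih j hlt (by omega), sub_self]
      · rw [Nat.choose_eq_zero_of_lt (by simp at hj; omega)]; simp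
    · intro hk'; simp at hk'; omega

theorem coeff_derangementDescentPoly_eq (n k : ℕ) :
    (derangementDescentPoly (n + 1)).coeff k = derangementEulerian (n + 1) k := by
  rcases le_or_gt k n with h | h
  · exact eq_of_sum_mul_choose_eq (fun m => by
      rw [sum_coeff_mul_choose, sum_derangementEulerian_mul_choose]) k h
  · rw [coeff_derangementDescentPoly_of_lt h, derangementEulerian.eq_zero_of_le _ _ h]

/-! ### Unimodality and the main theorem. -/

namespace derangementEulerian

theorem even_unimodal (n : ℕ) (hn : 1 ≤ n) :
    (∀ i < n, derangementEulerian (2 * n) i ≤ derangementEulerian (2 * n) (i + 1)) ∧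
    ∀ i ≥ n, derangementEulerian (2 * n) (i + 1) ≤ derangementEulerian (2 * n) i ∨
      2 * n ≤ i + 1 := by
  have a := apply_zero (2 * n - 1)
  rw [show 2 * n - 1 + 1 = 2 * n by omega] at a
  constructor
  · intro i hi
    rcases i with _ | i
    · have := apply_one_pos (2 * n - 2)
      rw [show 2 * n - 2 + 2 = 2 * n by omega] at this
      rw [a]; exact this.le
    · obtain ⟨m, hm⟩ : ∃ m, n = i + m + 2 := ⟨n - i - 2, by omega⟩
      have h := (evenChain n hn i m hm).2.1
      rcases m with _ | m
      · exact h
      · have h' := (evenChain n hn (i + 1) m (by omega)).1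
        rw [show i + 1 + 2 * m + 3 = i + 2 * (m + 1) + 2 by ring] at h'
        exact h.trans h'.le
  · intro i hi
    rcases le_or_gt (2 * n) (i + 1) with h | h
    · exact Or.inr h
    left
    obtain ⟨r, m, rfl, rfl⟩ : ∃ r m, n = r + m + 2 ∧ i = r + 2 * m + 2 :=
      ⟨2 * n - i - 2, i - n, by omega, by omega⟩
    have h := evenChain _ hn r m rfl
    exact (h.1.trans_le h.2.1).le

theorem odd_unimodal (n : ℕ) (hn : 1 ≤ n) :
    (∀ i < n, derangementEulerian (2 * n + 1) i ≤ derangementEulerian (2 * n + 1) (i + 1)) ∧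
    ∀ i ≥ n, derangementEulerian (2 * n + 1) (i + 1) ≤ derangementEulerian (2 * n + 1) i ∨
      2 * n ≤ i + 1 := by
  constructor
  · intro i hi
    rcases i with _ | i
    · have := apply_one_pos (2 * n - 1)
      rw [show 2 * n - 1 + 2 = 2 * n + 1 by omega] at this
      rw [apply_zero]; exact this.le
    · obtain ⟨m, hm⟩ : ∃ m, n = i + m + 2 := ⟨n - i - 2, by omega⟩
      have h := oddChain n hn i m hm
      exact (h.1.trans h.2).le
  · intro i hi
    rcases le_or_gt (2 * n) (i + 1) with h | h
    · exact Or.inr h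
    left
    obtain ⟨r, m, rfl, rfl⟩ : ∃ r m, n = r + m + 2 ∧ i = r + 2 * m + 2 :=
      ⟨2 * n - i - 2, i - n, by omega, by omega⟩
    have h := (oddChain _ hn r m rfl).2
    rcases m with _ | m
    · exact h.le
    · have h' := (oddChain _ hn (r + 1) m (by ring)).1
      rw [show r + 1 + 2 * m + 3 = r + 2 * (m + 1) + 2 by ring] at h'
      exact (h.trans h').le

end derangementEulerian

theorem isUnimodalPoly_of_coeff {h : ℤ[X]} {c N : ℕ} (hc : h.coeff c ≠ 0)
    (h1 : ∀ i < c, h.coeff i ≤ h.coeff (i + 1))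
    (h2 : ∀ i ≥ c, h.coeff (i + 1) ≤ h.coeff i ∨ N ≤ i + 1)
    (h3 : ∀ i ≥ N, h.coeff i = 0) (h4 : ∀ i, 0 ≤ h.coeff i) : IsUnimodalPoly h := by
  refine ⟨c, le_natDegree_of_ne_zero hc, h1, fun i hi _ => ?_⟩
  rcases h2 i hi with h | h
  · exact h
  · rw [h3 _ h]; exact h4 i

theorem isUnimodalPoly_derangementDescentPoly (n : ℕ) (hn : 2 ≤ n) :
    IsUnimodalPoly (derangementDescentPoly n) := by
  rcases Nat.even_or_odd' n with ⟨p, rfl | rfl⟩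
  · have e : ∀ k, (derangementDescentPoly (2 * p)).coeff k = derangementEulerian (2 * p) k := by
      obtain ⟨q, rfl⟩ : ∃ q, p = q + 1 := ⟨p - 1, by omega⟩
      exact coeff_derangementDescentPoly_eq (2 * q + 1)
    have hu := derangementEulerian.even_unimodal p (by omega)
    refine isUnimodalPoly_of_coeff (c := p) (N := 2 * p) ?_ ?_ ?_ ?_
      (coeff_derangementDescentPoly_nonneg _)
    · rw [e]; exact (derangementEulerian.middle_pos p (by omega)).1.ne'
    · simpa only [e] using hu.1
    · simpa only [e] using hu.2
    · intro i hi
      have := derangementEulerian.eq_zero_of_le (2 * p - 1) i (by omega)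
      rwa [show 2 * p - 1 + 1 = 2 * p by omega, ← e] at this
  · have e := coeff_derangementDescentPoly_eq (2 * p)
    have hu := derangementEulerian.odd_unimodal p (by omega)
    -- In odd rows the entry at index 2p is already 0, so N can be 2p here too.
    refine isUnimodalPoly_of_coeff (c := p) (N := 2 * p) ?_ ?_ ?_ ?_
      (coeff_derangementDescentPoly_nonneg _)
    · rw [e]; exact (derangementEulerian.middle_pos p (by omega)).2.ne'
    · simpa only [e] using hu.1
    · simpa only [e] using hu.2
    · intro i hi
      rw [e]
      rcases hi.eq_or_lt with rfl | hi
      · rw [derangementEulerian.apply_last, if_neg (by omega)]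
      · exact derangementEulerian.eq_zero_of_le _ _ hi

theorem theorem2 :
    (∀ n k : ℕ, 1 ≤ n → 1 ≤ k → k ≤ n - 1 →
      ((derangementDescentPoly (2 * n)).coeff (2 * n - k)
          < (derangementDescentPoly (2 * n)).coeff k ∧
        (¬ (n = 2 ∧ k = 1) →
          (derangementDescentPoly (2 * n)).coeff k
            < (derangementDescentPoly (2 * n)).coeff (2 * n - k - 1))) ∧
      ((derangementDescentPoly (2 * n + 1)).coeff k
          < (derangementDescentPoly (2 * n + 1)).coeff (2 * n - k) ∧
        (derangementDescentPoly (2 * n + 1)).coeff (2 * n - k)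
          < (derangementDescentPoly (2 * n + 1)).coeff (k + 1))) ∧
    ((derangementDescentPoly 4).coeff 1 = 4 ∧ (derangementDescentPoly 4).coeff 2 = 4) ∧
    (∀ n : ℕ, 2 ≤ n → IsUnimodalPoly (derangementDescentPoly n)) := by
  refine ⟨?_, ?_, isUnimodalPoly_derangementDescentPoly⟩
  · intro n k hn hk hkn
    obtain ⟨i, rfl⟩ : ∃ i, k = i + 1 := ⟨k - 1, by omega⟩
    obtain ⟨m, rfl⟩ : ∃ m, n = i + m + 2 := ⟨n - i - 2, by omega⟩
    have e : ∀ j, (derangementDescentPoly (2 * (i + m + 2))).coeff j =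
        derangementEulerian (2 * (i + m + 2)) j :=
      coeff_derangementDescentPoly_eq (2 * (i + m + 1) + 1)
    rw [show 2 * (i + m + 2) - (i + 1) = i + 2 * m + 3 by omega,
      show i + 2 * m + 3 - 1 = i + 2 * m + 2 by omega]
    simp only [e, coeff_derangementDescentPoly_eq (2 * (i + m + 2))]
    have h1 := derangementEulerian.evenChain _ hn i m rfl
    have h2 := derangementEulerian.oddChain _ hn i m rfl
    exact ⟨⟨h1.1, fun h => h1.2.2 (by omega)⟩, h2⟩
  · rw [coeff_derangementDescentPoly_eq, coeff_derangementDescentPoly_eq]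
    decide
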